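/- Let $n\ge 1$, $K\in\{1,-1\}$, and let $(\mathbb{M}^{n+1}(K),\bar g)$ be the unit sphere $\mathbb{S}^{n+1}$ if $K=1$ and the hyperbolic space $\mathbb{H}^{n+1}$ (sectional curvature $-1$) if $K=-1$. Let $\overline\nabla$ and $\overline\nabla^2$ denote its Levi-Civita connection and its Hessian, and $\bar d$ its geodesic distance. Put $\psi(r)=\sin r$ if $K=1$ and $\psi(r)=\sinh r$ if $K=-1$. Let $S_{K,\kappa}\subset\mathbb{M}^{n+1}(K)$ be a connected embedded smooth umbilical hypersurface with a smooth unit normal field $\bar N$ and constant principal curvature $\kappa\in\mathbb{R}$, i.e. $\overline\nabla_w\bar N=\kappa w$ for all vectors $w$ tangent to $S_{K,\kappa}$. Then for every $\widetilde c\in\mathbb{R}$ there is a function $\varphi\in C^\infty(\mathbb{M}^{n+1}(K))$ with $$\overline\nabla^2\varphi=\Big(\frac1{n+1}-K\varphi\Big)\bar g\ \text{ on } \mathbb{M}^{n+1}(K),\qquad \partial_{\bar N}\varphi=\kappa\varphi+\widetilde c\ \text{ on } S_{K,\kappa}.$$ Moreover, $\varphi$ can be chosen of the form $$\varphi(x)=c_0\,\psi'\big(\bar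 d(x,p)\big)+\frac{K}{n+1}$$ for a constant $c_0\in\mathbb{R}$ and a base point $p\in\mathbb{M}^{n+1}(K)$, in such a way that $p$ is a centre of $S_{K,\kappa}$ (all points of $S_{K,\kappa}$ have the same distance from $p$) whenever $S_{K,\kappa}$ lies in some geodesic sphere, and that $c_0=1$ (only the base point is adapted to $\widetilde c$) if $K=-1$ and $\kappa=0$. -/

import Mathlib

open scoped ContDiff

namespace SpaceFormGeometry

noncomputable section

/-! ### Riemannian geometry in coordinates -/

/-- The coordinate space `ℝ^m`. -/
abbrev Coord (m : ℕ) : Type := EuclideanSpace ℝ (Fin m)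

/-- The partial derivative `∂_i f` at `x`. -/
def pderiv {m : ℕ} {W : Type*} [NormedAddCommGroup W] [NormedSpace ℝ W]
    (i : Fin m) (f : Coord m → W) (x : Coord m) : W :=
  fderiv ℝ f x (EuclideanSpace.single i 1)

/-- The Christoffel symbol `Γ^k_{ij}` at `x` of the Levi-Civita connection of the metric
`g = (g_{ij})`, that is
`Γ^k_{ij} = 1/2 ∑_l g^{kl} (∂_i g_{jl} + ∂_j g_{il} - ∂_l g_{ij})`. -/
def christoffel {m : ℕ} (g : Coord m → Matrix (Fin m) (Fin m) ℝ) (x : Coord m)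
    (k i j : Fin m) : ℝ :=
  (1 / 2) * ∑ l : Fin m, (g x)⁻¹ k l *
    (pderiv i (fun y => g y j l) x + pderiv j (fun y => g y i l) x
      - pderiv l (fun y => g y i j) x)

/-- The component `∇²_{ij} f = ∂_i ∂_j f - ∑_k Γ^k_{ij} ∂_k f` of the Riemannian Hessian. -/
def hessian {m : ℕ} (g : Coord m → Matrix (Fin m) (Fin m) ℝ) (f : Coord m → ℝ)
    (x : Coord m) (i j : Fin m) : ℝ :=
  pderiv i (fun y => pderiv j f y) x - ∑ k : Fin m, christoffel g x k i j * pderiv k f x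

/-- The `k`-th component of the covariant derivative `∇_{∂_a ι} ν` at the parameter `z` of a
vector field `ν` along a map `ι`, that is `∂_a ν^k + ∑_{i,j} Γ^k_{ij}(ι) ∂_a ι^i ν^j`. -/
def covDerivAlong {m l : ℕ} (g : Coord m → Matrix (Fin m) (Fin m) ℝ)
    (ι ν : Coord l → Coord m) (z : Coord l) (a : Fin l) (k : Fin m) : ℝ :=
  pderiv a ν z k
    + ∑ i : Fin m, ∑ j : Fin m, christoffel g (ι z) k i j * pderiv a ι z i * ν z j

/-! ### The space forms `𝕊^{n+1}` (`K = 1`) and `ℍ^{n+1}` (`K = -1`) -/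

/-- The ambient vector space `ℝ × ℝ^{n+1}`. -/
abbrev Ambient (n : ℕ) : Type := ℝ × Coord (n + 1)

/-- The bilinear form `⟨(t, x), (s, y)⟩ = K t s + x · y`: the Euclidean one for `K = 1` and the
Minkowski one for `K = -1`. -/
def form (K : ℝ) {n : ℕ} (v w : Ambient n) : ℝ :=
  K * v.1 * w.1 + inner ℝ v.2 w.2

/-- For `K = 1` the unit sphere in `ℝ^{n+2}`; for `K = -1` the upper sheet of the hyperboloid
`⟨p, p⟩ = -1` in Minkowski space. Both carry the Riemannian metric induced by `form K`. -/
def spaceForm (K : ℝ) (n : ℕ) : Set (Ambient n) :=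
  {p | form K p p = K ∧ (K < 0 → 0 < p.1)}

/-- `F : U → M` is a smooth local parametrization (the inverse of a chart) of the space form. -/
structure IsParam (K : ℝ) {n : ℕ} (U : Set (Coord (n + 1)))
    (F : Coord (n + 1) → spaceForm K n) : Prop where
  isOpen : IsOpen U
  contDiffOn : ContDiffOn ℝ ∞ (fun x => (F x : Ambient n)) U
  injOn : Set.InjOn F U
  injective_fderiv : ∀ x ∈ U, Function.Injective (fderiv ℝ (fun x => (F x : Ambient n)) x)

/-- The components `g_{ij}` of the metric of the space form in a local parametrization `F`. -/
def metricIn (K : ℝ) {n : ℕ} (F : Coord (n + 1) → spaceForm K n) (x : Coord (n + 1)) :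
    Matrix (Fin (n + 1)) (Fin (n + 1)) ℝ :=
  Matrix.of fun i j =>
    form K (pderiv i (fun y => (F y : Ambient n)) x) (pderiv j (fun y => (F y : Ambient n)) x)

/-- `φ ∈ C^∞(M)`. -/
def IsSmooth (K : ℝ) {n : ℕ} (φ : spaceForm K n → ℝ) : Prop :=
  ∀ (U : Set (Coord (n + 1))) (F : Coord (n + 1) → spaceForm K n), IsParam K U F →
    ContDiffOn ℝ ∞ (fun x => φ (F x)) U

/-- `∇² φ = ρ g` on all of `M`, for functions `φ`, `ρ` on `M`. -/
def HessianEq (K : ℝ) {n : ℕ} (φ ρ : spaceForm K n → ℝ) : Prop :=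
  ∀ (U : Set (Coord (n + 1))) (F : Coord (n + 1) → spaceForm K n), IsParam K U F →
    ∀ x ∈ U, ∀ i j : Fin (n + 1),
      hessian (metricIn K F) (fun y => φ (F y)) x i j = ρ (F x) * metricIn K F x i j

/-- `∂_v φ = c` at the point `p`, for a tangent vector `v` of `M` at `p`. -/
def DirDerivEq (K : ℝ) {n : ℕ} (φ : spaceForm K n → ℝ) (p : spaceForm K n) (v : Ambient n)
    (c : ℝ) : Prop :=
  ∀ (U : Set (Coord (n + 1))) (F : Coord (n + 1) → spaceForm K n), IsParam K U F →
    ∀ x ∈ U, F x = p → ∀ e : Coord (n + 1),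
      fderiv ℝ (fun y => (F y : Ambient n)) x e = v → fderiv ℝ (fun y => φ (F y)) x e = c

/-- `S` is a connected embedded smooth umbilical hypersurface of the space form with unit normal
field `N` and constant principal curvature `κ` with respect to `N`, that is `∇_w N = κ w` for all
tangent vectors `w` of `S`. Near each point, `S` is parametrized by `F ∘ ι`, where `F` is a local
parametrization of the space form, and `ν` is the expression of `N` in the coordinates of `F`. -/
structure IsUmbilical (K κ : ℝ) {n : ℕ} (S : Set (spaceForm K n))
    (N : spaceForm K n → Ambient n) : Prop where
  isConnected : IsConnected S
  local_form : ∀ p ∈ S, ∃ (U : Set (Coord (n + 1))) (F : Coord (n + 1) → spaceForm K n)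
    (W : Set (Coord n)) (ι ν : Coord n → Coord (n + 1)),
    IsParam K U F ∧
    -- `F ∘ ι` is an embedded smooth parametrization of a neighbourhood of `p` in `S`
    IsOpen W ∧ Set.MapsTo ι W U ∧ ContDiffOn ℝ ∞ ι W ∧
    (∀ z ∈ W, Function.Injective (fderiv ℝ ι z)) ∧
    Topology.IsEmbedding (W.domRestrict (F ∘ ι)) ∧
    p ∈ (F ∘ ι) '' W ∧ (∃ O : Set (spaceForm K n), IsOpen O ∧ (F ∘ ι) '' W = S ∩ O) ∧
    -- `ν` represents `N`, is smooth, of unit length and normal to `S`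
    ContDiffOn ℝ ∞ ν W ∧
    (∀ z ∈ W, N (F (ι z)) = fderiv ℝ (fun y => (F y : Ambient n)) (ι z) (ν z)) ∧
    (∀ z ∈ W, ∑ i, ∑ j, metricIn K F (ι z) i j * ν z i * ν z j = 1) ∧
    (∀ z ∈ W, ∀ a : Fin n, ∑ i, ∑ j, metricIn K F (ι z) i j * ν z i * pderiv a ι z j = 0) ∧
    -- all principal curvatures equal `κ`
    (∀ z ∈ W, ∀ (a : Fin n) (k : Fin (n + 1)),
      covDerivAlong (metricIn K F) ι ν z a k = κ * pderiv a ι z k)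

/-- The geodesic distance: the angle `arccos ⟨p, q⟩` on the sphere and `arcosh (-⟨p, q⟩)` on
hyperbolic space. -/
def geodesicDist (K : ℝ) {n : ℕ} (p q : spaceForm K n) : ℝ :=
  if 0 < K then Real.arccos (form K (p : Ambient n) q)
  else Real.arcosh (-form K (p : Ambient n) q)

/-- The warping function `ψ` of the metric `dr² + ψ(r)² g_{𝕊^n}` of the space form: `sin` on the
sphere and `sinh` on hyperbolic space. -/
def warping (K : ℝ) : ℝ → ℝ := if 0 < K then Real.sin else Real.sinh

end

end SpaceFormGeometry

namespace SpaceFormGeometry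

noncomputable section

/-! Write ⟨·,·⟩ for `form K`. In the ambient space ℝ × ℝ^{n+1} the functions sought are affine in
the position vector: φ(x) = ⟨x, a⟩ + K/(n+1). The Gauss formula (`IsParam.gauss_formula`) says that
the second derivatives of a parametrization have position component -K g, so ∇²⟨x, a⟩ = -K⟨x, a⟩ g
(`IsParam.hessian_affine`), and K² = 1 gives the Hessian equation.

Umbilicity makes A = N - κx a constant vector along S (`IsUmbilical.exists_axis`), with ⟨A, A⟩ = 1 +
κ²K and ⟨x, A⟩ = -κK. Hence ∂_N φ = ⟨κx + A, a⟩, and the boundary condition becomes the single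
linear equation ⟨A, a⟩ = C with C = κK/(n+1) + c̃. Since ψ'(d(x, p)) = K⟨x, p⟩
(`deriv_warping_geodesicDist`), a = c₀Kp gives the required form, and c₀⟨A, p⟩ = KC remains to be
solved with p in the space form. `IsUmbilical.exists_base_point` does this according to the causal
type of A; when A can be normalized into the space form, p is a multiple of A and so a centre of S.
In the other hyperbolic cases S lies in no geodesic sphere, because a centre would be a multiple of
A (`IsUmbilical.eq_smul_axis`). -/

/-! ### The ambient bilinear form -/

/-- `form K` as a continuous bilinear map. -/
def formL (K : ℝ) (n : ℕ) : Ambient n →L[ℝ] Ambient n →L[ℝ] ℝ :=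
  let b : Coord (n + 1) →L[ℝ] Coord (n + 1) →L[ℝ] ℝ := innerSL ℝ
  K • (ContinuousLinearMap.mul ℝ ℝ).bilinearComp (ContinuousLinearMap.fst ℝ ℝ (Coord (n + 1)))
      (ContinuousLinearMap.fst ℝ ℝ (Coord (n + 1)))
    + b.bilinearComp (ContinuousLinearMap.snd ℝ ℝ (Coord (n + 1)))
      (ContinuousLinearMap.snd ℝ ℝ (Coord (n + 1)))

lemma formL_apply (K : ℝ) {n : ℕ} (v w : Ambient n) : formL K n v w = form K v w := by
  simp [formL, form, mul_assoc]
  rfl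

lemma form_comm (K : ℝ) {n : ℕ} (v w : Ambient n) : form K v w = form K w v := by
  simp only [form, real_inner_comm v.2 w.2]; ring

lemma form_add_left (K : ℝ) {n : ℕ} (u v w : Ambient n) :
    form K (u + v) w = form K u w + form K v w := by
  simp [← formL_apply]

lemma form_add_right (K : ℝ) {n : ℕ} (u v w : Ambient n) :
    form K u (v + w) = form K u v + form K u w := by
  simp [← formL_apply]

lemma form_sub_left (K : ℝ) {n : ℕ} (u v w : Ambient n) :
    form K (u - v) w = form K u w - form K v w := by
  simp [← formL_apply]

lemma form_smul_left (K : ℝ) {n : ℕ} (c : ℝ) (v w : Ambient n) :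
    form K (c • v) w = c * form K v w := by
  simp [← formL_apply]

lemma form_smul_right (K : ℝ) {n : ℕ} (c : ℝ) (v w : Ambient n) :
    form K v (c • w) = c * form K v w := by
  simp [← formL_apply]

lemma form_sum_left (K : ℝ) {n : ℕ} {α : Type*} (s : Finset α) (f : α → Ambient n)
    (w : Ambient n) : form K (∑ i ∈ s, f i) w = ∑ i ∈ s, form K (f i) w := by
  simp [← formL_apply, map_sum]

lemma form_sum_right (K : ℝ) {n : ℕ} {α : Type*} (s : Finset α) (v : Ambient n)
    (f : α → Ambient n) : form K v (∑ i ∈ s, f i) = ∑ i ∈ s, form K v (f i) := by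
  simp [← formL_apply, map_sum]

lemma form_zero_left (K : ℝ) {n : ℕ} (w : Ambient n) : form K 0 w = 0 := by
  simp [← formL_apply]

/-- The bilinear form is nondegenerate. -/
lemma eq_zero_of_form_eq_zero {K : ℝ} (hK : K ≠ 0) {n : ℕ} {v : Ambient n}
    (h : ∀ w, form K v w = 0) : v = 0 := by
  have h1 := h (v.1, 0)
  have h2 := h (0, v.2)
  simp [form, hK] at h1 h2
  exact Prod.ext h1 h2

/-- A vector orthogonal to the range of an injective map from a space of full dimension is zero. -/
lemma eq_zero_of_form_range {K : ℝ} (hK : K ≠ 0) {n : ℕ} {E : Type*} [AddCommGroup E]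
    [Module ℝ E] [FiniteDimensional ℝ E] (L : E →ₗ[ℝ] Ambient n) (hL : ∀ e, L e = 0 → e = 0)
    (hE : Module.finrank ℝ E = n + 2) {v : Ambient n} (h : ∀ e, form K v (L e) = 0) : v = 0 := by
  have hinj : Function.Injective L := (injective_iff_map_eq_zero L).2 hL
  have hsurj : Function.Surjective L := by
    refine (LinearMap.injective_iff_surjective_of_finrank_eq_finrank ?_).1 hinj
    rw [hE]; simp; ring
  refine eq_zero_of_form_eq_zero hK fun w => ?_
  obtain ⟨e, rfl⟩ := hsurj w
  exact h e

/-! ### Local parametrizations -/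

section Param

variable {K : ℝ} {n : ℕ} {U : Set (Coord (n + 1))} {F : Coord (n + 1) → spaceForm K n}

/-- The first derivative of a local parametrization. -/
abbrev dParam (F : Coord (n + 1) → spaceForm K n) (x : Coord (n + 1)) :
    Coord (n + 1) →L[ℝ] Ambient n :=
  fderiv ℝ (fun y => (F y : Ambient n)) x

/-- The second derivative of a local parametrization. -/
abbrev ddParam (F : Coord (n + 1) → spaceForm K n) (x : Coord (n + 1)) :
    Coord (n + 1) →L[ℝ] Coord (n + 1) →L[ℝ] Ambient n :=
  fderiv ℝ (dParam F) x

lemma form_self (p : spaceForm K n) : form K (p : Ambient n) p = K := p.2.1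

lemma sum_single {m : ℕ} (v : Coord m) : ∑ i, v i • EuclideanSpace.single i (1 : ℝ) = v := by
  ext j
  simp [Finset.sum_apply, Pi.single_apply]

lemma map_eq_sum {m : ℕ} {W : Type*} [NormedAddCommGroup W] [NormedSpace ℝ W]
    (L : Coord m →L[ℝ] W) (v : Coord m) : L v = ∑ i, v i • L (EuclideanSpace.single i 1) := by
  conv_lhs => rw [← sum_single v]
  simp [map_sum]

lemma HasFDerivAt.form_apply {E : Type*} [NormedAddCommGroup E] [NormedSpace ℝ E]
    {f g : E → Ambient n} {f' g' : E →L[ℝ] Ambient n} {x : E}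
    (hf : HasFDerivAt f f' x) (hg : HasFDerivAt g g' x) (v : E) :
    fderiv ℝ (fun y => form K (f y) (g y)) x v
      = form K (f' v) (g x) + form K (f x) (g' v) := by
  have := ((formL K n).hasFDerivAt_of_bilinear hf hg).fderiv
  simp only [formL_apply] at this
  rw [this]
  simp [formL_apply, add_comm]

namespace IsParam

lemma contDiffAt (h : IsParam K U F) {x : Coord (n + 1)} (hx : x ∈ U) :
    ContDiffAt ℝ ∞ (fun y => (F y : Ambient n)) x :=
  h.contDiffOn.contDiffAt (h.isOpen.mem_nhds hx)

lemma hasFDerivAt (h : IsParam K U F) {x : Coord (n + 1)} (hx : x ∈ U) :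
    HasFDerivAt (fun y => (F y : Ambient n)) (dParam F x) x :=
  ((h.contDiffAt hx).differentiableAt (by simp)).hasFDerivAt

lemma hasFDerivAt_dParam (h : IsParam K U F) {x : Coord (n + 1)} (hx : x ∈ U) :
    HasFDerivAt (dParam F) (ddParam F x) x :=
  (((h.contDiffAt hx).fderiv_right (m := 1) (by norm_cast)).differentiableAt
    (by simp)).hasFDerivAt

lemma hasFDerivAt_dParam_apply (h : IsParam K U F) {x : Coord (n + 1)} (hx : x ∈ U)
    (v : Coord (n + 1)) :
    HasFDerivAt (fun y => dParam F y v) ((ddParam F x).flip v) x := by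
  have := (h.hasFDerivAt_dParam hx).clm_apply (hasFDerivAt_const v x)
  rwa [ContinuousLinearMap.comp_zero, zero_add] at this

lemma ddParam_symm (h : IsParam K U F) {x : Coord (n + 1)} (hx : x ∈ U)
    (u v : Coord (n + 1)) : ddParam F x u v = ddParam F x v u :=
  ((h.contDiffAt hx).isSymmSndFDerivAt (by simp; exact WithTop.coe_le_coe.2 le_top)).eq u v

lemma form_dParam (h : IsParam K U F) {x : Coord (n + 1)} (hx : x ∈ U) (v : Coord (n + 1)) :
    form K (dParam F x v) (F x : Ambient n) = 0 := by
  have h1 := HasFDerivAt.form_apply (K := K) (h.hasFDerivAt hx) (h.hasFDerivAt hx) v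
  simp only [form_self] at h1
  rw [form_comm K (F x : Ambient n)] at h1
  simp at h1
  linarith

/-- Differentiate the tangency relation `form_dParam` once more. -/
lemma form_ddParam (h : IsParam K U F) {x : Coord (n + 1)} (hx : x ∈ U)
    (u v : Coord (n + 1)) :
    form K (ddParam F x u v) (F x : Ambient n) = - form K (dParam F x u) (dParam F x v) := by
  have h1 := HasFDerivAt.form_apply (K := K) (h.hasFDerivAt_dParam_apply hx v) (h.hasFDerivAt hx) u
  have h2 : (fun y => form K (dParam F y v) (F y : Ambient n)) =ᶠ[nhds x] fun _ => 0 := by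
    filter_upwards [h.isOpen.mem_nhds hx] with y hy using h.form_dParam hy v
  rw [h2.fderiv_eq] at h1
  simp at h1
  rw [form_comm K (dParam F x v)] at h1
  linarith

/-- A vector orthogonal to the position vector and to the tangent space is zero. -/
lemma eq_zero_of_form (h : IsParam K U F) (hK : K ≠ 0) {x : Coord (n + 1)} (hx : x ∈ U)
    {v : Ambient n} (h0 : form K v (F x : Ambient n) = 0)
    (h1 : ∀ i, form K v (dParam F x (EuclideanSpace.single i 1)) = 0) : v = 0 := by
  -- The map (s, w) ↦ sF(x) + dF(w) is injective: pairing with F(x) leaves sK = 0, and dF is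
  -- injective.
  refine eq_zero_of_form_range hK (E := ℝ × Coord (n + 1))
    (LinearMap.coprod (LinearMap.toSpanSingleton ℝ _ (F x : Ambient n))
      (dParam F x : Coord (n + 1) →ₗ[ℝ] Ambient n)) ?_ (by simp; ring) ?_
  · rintro ⟨s, w⟩ hsw
    simp only [LinearMap.coprod_apply, LinearMap.toSpanSingleton_apply,
      ContinuousLinearMap.coe_coe] at hsw
    have h2 := congrArg (fun z => form K z (F x : Ambient n)) hsw
    simp only [form_add_left, form_smul_left, form_self, h.form_dParam hx, form_zero_left] at h2
    have hs : s = 0 := by simpa [hK] using h2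
    subst hs
    have : w = 0 := h.injective_fderiv x hx (by simpa using hsw)
    simp [this]
  · rintro ⟨s, w⟩
    simp only [LinearMap.coprod_apply, LinearMap.toSpanSingleton_apply,
      ContinuousLinearMap.coe_coe]
    rw [map_eq_sum (dParam F x) w, form_add_right, form_smul_right, h0, form_sum_right]
    simp [form_smul_right, h1]

/-! ### Metric, Christoffel symbols and Gauss formula -/

lemma metricIn_apply (F : Coord (n + 1) → spaceForm K n) (x : Coord (n + 1))
    (i j : Fin (n + 1)) :
    metricIn K F x i j = form K (dParam F x (EuclideanSpace.single i 1))
      (dParam F x (EuclideanSpace.single j 1)) := rfl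

lemma form_dParam_dParam (F : Coord (n + 1) → spaceForm K n) (x u v : Coord (n + 1)) :
    form K (dParam F x u) (dParam F x v) = ∑ i, ∑ j, metricIn K F x i j * u i * v j := by
  rw [map_eq_sum (dParam F x) u, form_sum_left]
  refine Finset.sum_congr rfl fun i _ => ?_
  rw [form_smul_left, form_comm, map_eq_sum (dParam F x) v, form_sum_left, Finset.mul_sum]
  refine Finset.sum_congr rfl fun j _ => ?_
  rw [form_smul_left, form_comm, metricIn_apply]; ring

/-- A kernel vector of g would give a tangent vector orthogonal to the tangent space and to the
position vector, hence zero. Only nondegeneracy of the ambient form enters, so the Minkowski case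
needs no separate proof of positivity. -/
lemma isUnit_det_metricIn (h : IsParam K U F) (hK : K ≠ 0) {x : Coord (n + 1)} (hx : x ∈ U) :
    IsUnit (metricIn K F x).det := by
  rw [isUnit_iff_ne_zero]
  intro hdet
  obtain ⟨v, hv, hgv⟩ := Matrix.exists_mulVec_eq_zero_iff.2 hdet
  apply hv
  have h0 : dParam F x (WithLp.toLp 2 v) = 0 := by
    refine h.eq_zero_of_form hK hx (h.form_dParam hx _) fun i => ?_
    rw [map_eq_sum (dParam F x), form_sum_left]
    have := congrFun hgv i
    simp only [Matrix.mulVec, dotProduct, metricIn_apply, Pi.zero_apply] at this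
    rw [← this]
    refine Finset.sum_congr rfl fun j _ => ?_
    rw [form_smul_left, form_comm]; ring
  have h1 : WithLp.toLp 2 v = (0 : Coord (n + 1)) := h.injective_fderiv x hx (by simpa using h0)
  simpa using congrArg WithLp.ofLp h1

lemma pderiv_metricIn (h : IsParam K U F) {x : Coord (n + 1)} (hx : x ∈ U)
    (l i j : Fin (n + 1)) :
    pderiv l (fun y => metricIn K F y i j) x =
      form K (ddParam F x (EuclideanSpace.single l 1) (EuclideanSpace.single i 1))
        (dParam F x (EuclideanSpace.single j 1))
      + form K (ddParam F x (EuclideanSpace.single l 1) (EuclideanSpace.single j 1))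
        (dParam F x (EuclideanSpace.single i 1)) := by
  have := HasFDerivAt.form_apply (K := K)
    (h.hasFDerivAt_dParam_apply hx (EuclideanSpace.single i 1))
    (h.hasFDerivAt_dParam_apply hx (EuclideanSpace.single j 1)) (EuclideanSpace.single l 1)
  rw [form_comm K (dParam F x (EuclideanSpace.single i 1))] at this
  exact this

/-- By the product rule and the symmetry of second derivatives, everything in ∂_i g_{jl} + ∂_j
g_{il} - ∂_l g_{ij} cancels except 2⟨∂_i∂_j F, ∂_l F⟩. -/
lemma christoffel_eq (h : IsParam K U F) {x : Coord (n + 1)} (hx : x ∈ U)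
    (k i j : Fin (n + 1)) :
    christoffel (metricIn K F) x k i j = ∑ l, (metricIn K F x)⁻¹ k l *
      form K (ddParam F x (EuclideanSpace.single i 1) (EuclideanSpace.single j 1))
        (dParam F x (EuclideanSpace.single l 1)) := by
  rw [christoffel, Finset.mul_sum]
  refine Finset.sum_congr rfl fun l _ => ?_
  simp only [h.pderiv_metricIn hx]
  rw [h.ddParam_symm hx (EuclideanSpace.single j 1) (EuclideanSpace.single i 1),
    h.ddParam_symm hx (EuclideanSpace.single l 1) (EuclideanSpace.single i 1),
    h.ddParam_symm hx (EuclideanSpace.single l 1) (EuclideanSpace.single j 1)]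
  ring

/-- The Gauss formula for the space form in its ambient space. -/
lemma gauss_formula (h : IsParam K U F) (hK : K * K = 1) {x : Coord (n + 1)} (hx : x ∈ U)
    (i j : Fin (n + 1)) :
    ddParam F x (EuclideanSpace.single i 1) (EuclideanSpace.single j 1) =
      ∑ k, christoffel (metricIn K F) x k i j • dParam F x (EuclideanSpace.single k 1)
        - (K * metricIn K F x i j) • (F x : Ambient n) := by
  have hK0 : K ≠ 0 := by rintro rfl; simp at hK
  rw [← sub_eq_zero]
  refine h.eq_zero_of_form hK0 hx ?_ fun m => ?_
  · simp only [form_sub_left, form_sum_left, form_smul_left, form_self, h.form_dParam hx,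
      h.form_ddParam hx, metricIn_apply]
    simp only [mul_zero, Finset.sum_const_zero]
    linear_combination (form K (dParam F x (EuclideanSpace.single i 1))
      (dParam F x (EuclideanSpace.single j 1))) * hK
  · simp only [form_sub_left, form_sum_left, form_smul_left]
    rw [form_comm K (F x : Ambient n), h.form_dParam hx, mul_zero, sub_zero, sub_eq_zero]
    simp only [h.christoffel_eq hx, ← metricIn_apply]
    set b : Fin (n + 1) → ℝ := fun l =>
      form K (ddParam F x (EuclideanSpace.single i 1) (EuclideanSpace.single j 1))
        (dParam F x (EuclideanSpace.single l 1)) with hb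
    set g := metricIn K F x with hg
    have hgs : ∀ a c, g a c = g c a := fun a c => form_comm K _ _
    have hinv : g * g⁻¹ = 1 := Matrix.mul_nonsing_inv _ (h.isUnit_det_metricIn hK0 hx)
    -- Lowering the index of the Christoffel symbols recovers the tangential products b.
    have h1 : (g * g⁻¹).mulVec b m = b m := by rw [hinv, Matrix.one_mulVec]
    rw [← Matrix.mulVec_mulVec] at h1
    change b m = _
    rw [← h1]
    simp only [Matrix.mulVec, dotProduct]
    refine Finset.sum_congr rfl fun k _ => ?_
    rw [hgs m k, mul_comm]

/-- The Hessian of an affine function of the position vector. -/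
lemma hessian_affine (h : IsParam K U F) (hK : K * K = 1) {x : Coord (n + 1)} (hx : x ∈ U)
    (a : Ambient n) (c : ℝ) (i j : Fin (n + 1)) :
    hessian (metricIn K F) (fun y => form K (F y : Ambient n) a + c) x i j =
      - (K * form K (F x : Ambient n) a) * metricIn K F x i j := by
  have h1 : ∀ y ∈ U, ∀ k, pderiv k (fun y => form K (F y : Ambient n) a + c) y =
      form K (dParam F y (EuclideanSpace.single k 1)) a := by
    intro y hy k
    have := HasFDerivAt.form_apply (K := K) (h.hasFDerivAt hy) (hasFDerivAt_const a y)
      (EuclideanSpace.single k 1)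
    rw [pderiv, fderiv_add_const, this, form_comm K (F y : Ambient n)]
    simp [form_zero_left]
  have h2 : (fun y => pderiv j (fun y => form K (F y : Ambient n) a + c) y) =ᶠ[nhds x]
      fun y => form K (dParam F y (EuclideanSpace.single j 1)) a := by
    filter_upwards [h.isOpen.mem_nhds hx] with y hy using h1 y hy j
  have h3 := HasFDerivAt.form_apply (K := K)
    (h.hasFDerivAt_dParam_apply hx (EuclideanSpace.single j 1)) (hasFDerivAt_const a x)
    (EuclideanSpace.single i 1)
  rw [form_comm K (dParam F x (EuclideanSpace.single j 1))] at h3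
  simp only [ContinuousLinearMap.flip_apply, zero_apply, form_zero_left,
    add_zero] at h3
  rw [hessian, pderiv, h2.fderiv_eq, h3, h.gauss_formula hK hx]
  simp only [h1 x hx, form_sub_left, form_sum_left, form_smul_left]
  ring

lemma fderiv_affine (h : IsParam K U F) {x : Coord (n + 1)} (hx : x ∈ U)
    (a : Ambient n) (c : ℝ) (e : Coord (n + 1)) :
    fderiv ℝ (fun y => form K (F y : Ambient n) a + c) x e = form K (dParam F x e) a := by
  have := HasFDerivAt.form_apply (K := K) (h.hasFDerivAt hx) (hasFDerivAt_const a x) e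
  rw [fderiv_add_const, this, form_comm K (F x : Ambient n)]
  simp [form_zero_left]

lemma contDiffOn_affine (h : IsParam K U F) (a : Ambient n) (c : ℝ) :
    ContDiffOn ℝ ∞ (fun x => form K (F x : Ambient n) a + c) U := by
  have := ((formL K n).flip a).contDiff.comp_contDiffOn h.contDiffOn (n := ∞)
  simpa [Function.comp_def, formL_apply] using this.add (contDiffOn_const (c := c))

end IsParam

end Param

/-! ### Umbilical hypersurfaces -/

section Umbilical

variable {K κ : ℝ} {n : ℕ}

/-- The Gauss formula along a map: the ambient derivative of a tangent field is its covariant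
derivative plus a multiple of the position vector. This turns the intrinsic umbilicity condition
into an ambient one. -/
lemma IsParam.dParam_covDerivAlong {U : Set (Coord (n + 1))} {F : Coord (n + 1) → spaceForm K n}
    (h : IsParam K U F) (hK : K * K = 1) {l : ℕ} {ι ν : Coord l → Coord (n + 1)} {z : Coord l}
    (hz : ι z ∈ U) (hι : DifferentiableAt ℝ ι z) (hν : DifferentiableAt ℝ ν z) (a : Fin l) :
    pderiv a (fun y => dParam F (ι y) (ν y)) z =
      ∑ k, covDerivAlong (metricIn K F) ι ν z a k • dParam F (ι z) (EuclideanSpace.single k 1)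
        - (K * ∑ i, ∑ j, metricIn K F (ι z) i j * pderiv a ι z i * ν z j) •
          (F (ι z) : Ambient n) := by
  have h1 : pderiv a (fun y => dParam F (ι y) (ν y)) z =
      dParam F (ι z) (pderiv a ν z) + ddParam F (ι z) (pderiv a ι z) (ν z) := by
    have h2 : HasFDerivAt (fun y => dParam F (ι y)) ((ddParam F (ι z)).comp (fderiv ℝ ι z)) z :=
      HasFDerivAt.comp z (h.hasFDerivAt_dParam hz) hι.hasFDerivAt
    have h3 := (h2.clm_apply hν.hasFDerivAt).fderiv
    rw [pderiv, h3]
    rfl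
  have h4 : ddParam F (ι z) (pderiv a ι z) (ν z) = ∑ i, ∑ j, (pderiv a ι z i * ν z j) •
      ddParam F (ι z) (EuclideanSpace.single i 1) (EuclideanSpace.single j 1) := by
    rw [map_eq_sum (ddParam F (ι z)) (pderiv a ι z), sum_apply]
    refine Finset.sum_congr rfl fun i _ => ?_
    rw [smul_apply, map_eq_sum _ (ν z), Finset.smul_sum]
    simp only [smul_smul]
  rw [h1, h4, map_eq_sum (dParam F (ι z)) (pderiv a ν z)]
  simp only [h.gauss_formula hK hz, covDerivAlong, add_smul, Finset.sum_add_distrib, smul_sub,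
    Finset.sum_sub_distrib, Finset.smul_sum, Finset.sum_smul, Finset.mul_sum, smul_smul]
  rw [add_sub_assoc]
  congr 1
  congr 1
  · conv_rhs => rw [Finset.sum_comm]
    refine (Finset.sum_congr rfl fun i _ => ?_)
    conv_rhs => rw [Finset.sum_comm]
    refine Finset.sum_congr rfl fun j _ => Finset.sum_congr rfl fun k _ => ?_
    congr 1; ring
  · refine Finset.sum_congr rfl fun i _ => Finset.sum_congr rfl fun j _ => ?_
    congr 1; ring

/-- An umbilical hypersurface near one of its points, in ambient coordinates. -/
lemma IsUmbilical.exists_local (hK : K * K = 1) {S : Set (spaceForm K n)}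
    {N : spaceForm K n → Ambient n} (hS : IsUmbilical K κ S N) {p : spaceForm K n} (hp : p ∈ S) :
    ∃ (W : Set (Coord n)) (X : Coord n → spaceForm K n), IsOpen W ∧
      Topology.IsEmbedding (W.domRestrict X) ∧ p ∈ X '' W ∧
      (∃ O : Set (spaceForm K n), IsOpen O ∧ X '' W = S ∩ O) ∧
      (∀ z ∈ W, DifferentiableAt ℝ (fun y => (X y : Ambient n)) z ∧
        Function.Injective (fderiv ℝ (fun y => (X y : Ambient n)) z) ∧
        HasFDerivAt (fun y => N (X y)) (κ • fderiv ℝ (fun y => (X y : Ambient n)) z) z ∧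
        form K (N (X z)) (N (X z)) = 1 ∧ form K (N (X z)) (X z : Ambient n) = 0 ∧
        ∀ v, form K (N (X z)) (fderiv ℝ (fun y => (X y : Ambient n)) z v) = 0) := by
  obtain ⟨U, F, W, ι, ν, hF, hW, hmaps, hι, hιinj, hemb, hpW, hO, hν, hN, hN1, hNt, hcov⟩ :=
    hS.local_form p hp
  refine ⟨W, F ∘ ι, hW, hemb, hpW, hO, fun z hz => ?_⟩
  have hιz : ∀ y ∈ W, DifferentiableAt ℝ ι y := fun y hy =>
    (hι.contDiffAt (hW.mem_nhds hy)).differentiableAt (by simp)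
  have hνz : DifferentiableAt ℝ ν z := (hν.contDiffAt (hW.mem_nhds hz)).differentiableAt (by simp)
  have hX : HasFDerivAt (fun y => ((F ∘ ι) y : Ambient n))
      ((dParam F (ι z)).comp (fderiv ℝ ι z)) z :=
    HasFDerivAt.comp z (hF.hasFDerivAt (hmaps hz)) (hιz z hz).hasFDerivAt
  have hNform : ∀ v, form K (N (F (ι z))) (dParam F (ι z) (fderiv ℝ ι z v)) = 0 := by
    intro v
    rw [map_eq_sum (fderiv ℝ ι z) v, map_sum, form_sum_right]
    refine Finset.sum_eq_zero fun a _ => ?_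
    rw [map_smul, form_smul_right, hN z hz]
    have := hNt z hz a
    rw [← IsParam.form_dParam_dParam] at this
    exact mul_eq_zero_of_right _ this
  have hNeq : (fun y => N ((F ∘ ι) y)) =ᶠ[nhds z] fun y => dParam F (ι y) (ν y) := by
    filter_upwards [hW.mem_nhds hz] with y hy using hN y hy
  have hNd : DifferentiableAt ℝ (fun y => dParam F (ι y) (ν y)) z :=
    ((hF.hasFDerivAt_dParam (hmaps hz)).comp z (hιz z hz).hasFDerivAt).differentiableAt.clm_apply
      hνz
  refine ⟨hX.differentiableAt, ?_, ?_, ?_, ?_, ?_⟩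
  · rw [hX.fderiv]
    exact (hF.injective_fderiv _ (hmaps hz)).comp (hιinj z hz)
  · refine HasFDerivAt.congr_of_eventuallyEq ?_ hNeq
    convert hNd.hasFDerivAt using 1
    rw [hX.fderiv]
    ext1 v
    rw [map_eq_sum _ v, map_eq_sum (fderiv ℝ (fun y => dParam F (ι y) (ν y)) z) v]
    refine Finset.sum_congr rfl fun a _ => ?_
    congr 1
    -- The position component vanishes because N is normal to S.
    have h0 : ∑ i, ∑ j, metricIn K F (ι z) i j * pderiv a ι z i * ν z j = 0 := by
      rw [← IsParam.form_dParam_dParam, form_comm, ← hN z hz]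
      exact hNform _
    have := hF.dParam_covDerivAlong hK (hmaps hz) (hιz z hz) hνz a
    rw [h0, mul_zero, zero_smul, sub_zero] at this
    change _ = pderiv a _ z
    rw [this]
    simp only [hcov z hz, mul_smul, ← Finset.smul_sum]
    rw [← map_eq_sum (dParam F (ι z)) (pderiv a ι z)]
    rfl
  · change form K (N (F (ι z))) (N (F (ι z))) = 1
    rw [hN z hz]
    exact (IsParam.form_dParam_dParam ..).trans (hN1 z hz)
  · change form K (N (F (ι z))) _ = 0
    rw [hN z hz]
    exact hF.form_dParam (hmaps hz) _
  · intro v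
    rw [hX.fderiv]
    exact hNform v

/-- `N - κ x` is constant along an umbilical hypersurface. -/
lemma IsUmbilical.exists_const (hK : K * K = 1) {S : Set (spaceForm K n)}
    {N : spaceForm K n → Ambient n} (hS : IsUmbilical K κ S N) :
    ∃ A : Ambient n, ∀ x ∈ S, N x = κ • (x : Ambient n) + A := by
  let f : S → Ambient n := fun x => N x - κ • ((x : spaceForm K n) : Ambient n)
  have hf : IsLocallyConstant f := by
    rw [IsLocallyConstant.iff_eventually_eq]
    rintro ⟨p, hp⟩
    obtain ⟨W, X, hW, hemb, ⟨z, hz, rfl⟩, ⟨O, hO, hXO⟩, hX⟩ := hS.exists_local hK hp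
    obtain ⟨r, hr, hball⟩ := Metric.isOpen_iff.1 hW z hz
    have hconst : ∀ y ∈ Metric.ball z r, N (X y) - κ • (X y : Ambient n) =
        N (X z) - κ • (X z : Ambient n) := by
      have hd : ∀ y ∈ Metric.ball z r,
          HasFDerivAt (fun y => N (X y) - κ • (X y : Ambient n))
            (0 : Coord n →L[ℝ] Ambient n) y := by
        intro y hy
        obtain ⟨h1, -, h2, -⟩ := hX y (hball hy)
        have h3 := h2.sub (h1.hasFDerivAt.const_smul κ)
        rwa [sub_self] at h3
      intro y hy
      exact Metric.isOpen_ball.is_const_of_fderiv_eq_zero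
        (convex_ball z r).isPreconnected
        (fun w hw => (hd w hw).differentiableAt.differentiableWithinAt)
        (fun w hw => (hd w hw).fderiv) hy (Metric.mem_ball_self hr)
    -- Constancy on a parameter ball gives constancy near the point of S, because the embedding
    -- makes the image of the ball relatively open.
    obtain ⟨V, hV, hVW⟩ := hemb.isInducing.isOpen_iff.1
      (Metric.isOpen_ball.preimage (continuous_subtype_val (p := (· ∈ W))) :
        IsOpen (Subtype.val ⁻¹' Metric.ball z r : Set W))
    have hmem : ∀ y (hy : y ∈ W), X y ∈ V ↔ y ∈ Metric.ball z r := fun y hy =>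
      Set.ext_iff.1 hVW ⟨y, hy⟩
    have hzO : X z ∈ O := (hXO.subset ⟨z, hz, rfl⟩).2
    filter_upwards [continuous_subtype_val.continuousAt.preimage_mem_nhds
      ((hV.inter hO).mem_nhds ⟨(hmem z hz).2 (Metric.mem_ball_self hr), hzO⟩)] with x hx
    obtain ⟨y, hy, hyx⟩ := hXO.symm.subset ⟨x.2, hx.2⟩
    have h1 := hconst y ((hmem y hy).1 (hyx ▸ hx.1))
    simpa only [f, hyx] using h1
  have : PreconnectedSpace S := isPreconnected_iff_preconnectedSpace.1 hS.isConnected.2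
  obtain ⟨x₀, hx₀⟩ := hS.isConnected.1
  refine ⟨f ⟨x₀, hx₀⟩, fun x hx => ?_⟩
  rw [hf.apply_eq_of_isPreconnected isPreconnected_univ (Set.mem_univ ⟨x₀, hx₀⟩)
    (Set.mem_univ ⟨x, hx⟩)]
  simp [f]

/-- The vector `N - κ x` of an umbilical hypersurface, with its inner products. -/
lemma IsUmbilical.exists_axis (hK : K * K = 1) {S : Set (spaceForm K n)}
    {N : spaceForm K n → Ambient n} (hS : IsUmbilical K κ S N) :
    ∃ A : Ambient n, (∀ x ∈ S, N x = κ • (x : Ambient n) + A) ∧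
      form K A A = 1 + κ ^ 2 * K ∧ ∀ x ∈ S, form K (x : Ambient n) A = -(κ * K) := by
  obtain ⟨A, hA⟩ := hS.exists_const hK
  have key : ∀ x ∈ S, form K (N x) (N x) = 1 ∧ form K (N x) (x : Ambient n) = 0 := by
    intro x hx
    obtain ⟨W, X, -, -, ⟨z, hz, rfl⟩, -, hX⟩ := hS.exists_local hK hx
    exact ⟨(hX z hz).2.2.2.1, (hX z hz).2.2.2.2.1⟩
  have hxA : ∀ x ∈ S, form K (x : Ambient n) A = -(κ * K) := by
    intro x hx
    have h := (key x hx).2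
    rw [hA x hx, form_add_left, form_smul_left, form_self, form_comm] at h
    linarith
  refine ⟨A, hA, ?_, hxA⟩
  obtain ⟨x, hx⟩ := hS.isConnected.1
  have h := (key x hx).1
  rw [hA x hx, form_add_left, form_add_right, form_add_right] at h
  simp only [form_smul_left, form_smul_right, form_self, hxA x hx, form_comm K A] at h
  linarith

/-- The centre of a sphere that contains an umbilical hypersurface is proportional to its axis. -/
lemma IsUmbilical.eq_smul_axis (hn : 1 ≤ n) (hK : K * K = 1) {S : Set (spaceForm K n)}
    {N : spaceForm K n → Ambient n} (hS : IsUmbilical K κ S N) {A : Ambient n}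
    (hA : ∀ x ∈ S, N x = κ • (x : Ambient n) + A) {q : Ambient n} {d : ℝ}
    (hq : ∀ x ∈ S, form K (x : Ambient n) q = d) : ∃ b : ℝ, q = b • A := by
  have hK0 : K ≠ 0 := by rintro rfl; simp at hK
  obtain ⟨p, hp⟩ := hS.isConnected.1
  obtain ⟨W, X, hW, hemb, ⟨z₀, hz₀, rfl⟩, ⟨O, hO, hXO⟩, hX⟩ := hS.exists_local hK hp
  have hmem : ∀ z ∈ W, X z ∈ S := fun z hz => (hXO.subset ⟨z, hz, rfl⟩).1
  have hqv : ∀ z ∈ W, ∀ v, form K (fderiv ℝ (fun y => (X y : Ambient n)) z v) q = 0 := by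
    intro z hz v
    have h1 := HasFDerivAt.form_apply (K := K) (hX z hz).1.hasFDerivAt (hasFDerivAt_const q z) v
    have h2 : (fun y => form K (X y : Ambient n) q) =ᶠ[nhds z] fun _ => d := by
      filter_upwards [hW.mem_nhds hz] with y hy using hq _ (hmem y hy)
    rw [h2.fderiv_eq, form_comm K (X z : Ambient n)] at h1
    simpa [form_zero_left] using h1.symm
  -- Being orthogonal to the tangent space of S, q is a combination of x and N, with coefficients
  -- read off from ⟨x, q⟩ and ⟨N, q⟩.
  have hspan : ∀ z ∈ W, q = (K * d) • (X z : Ambient n) + (κ * d + form K A q) • N (X z) := by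
    intro z hz
    obtain ⟨hXd, hinj, -, hNN, hNX, hNT⟩ := hX z hz
    have hNq : form K (N (X z)) q = κ * d + form K A q := by
      rw [hA _ (hmem z hz), form_add_left, form_smul_left, hq _ (hmem z hz)]
    have hXT : ∀ v, form K (X z : Ambient n) (fderiv ℝ (fun y => (X y : Ambient n)) z v) = 0 := by
      intro v
      have h1 := HasFDerivAt.form_apply (K := K) hXd.hasFDerivAt hXd.hasFDerivAt v
      simp only [form_self] at h1
      rw [form_comm K _ (X z : Ambient n)] at h1
      simp at h1
      linarith
    rw [← sub_eq_zero]
    refine eq_zero_of_form_range hK0 (E := (ℝ × ℝ) × Coord n)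
      (LinearMap.coprod (LinearMap.coprod (LinearMap.toSpanSingleton ℝ _ (X z : Ambient n))
        (LinearMap.toSpanSingleton ℝ _ (N (X z))))
        (fderiv ℝ (fun y => (X y : Ambient n)) z : Coord n →ₗ[ℝ] Ambient n)) ?_
        (by simp; ring) ?_
    · rintro ⟨⟨s, t⟩, w⟩ h
      simp only [LinearMap.coprod_apply, LinearMap.toSpanSingleton_apply,
        ContinuousLinearMap.coe_coe] at h
      have h2 := congrArg (fun y => form K (X z : Ambient n) y) h
      have h3 := congrArg (fun y => form K (N (X z)) y) h
      simp only [form_add_right, form_smul_right, form_self, hXT, hNN, hNX, hNT,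
        form_comm K (X z : Ambient n) (N (X z)), form_comm K _ (0 : Ambient n),
        form_zero_left] at h2 h3
      have hs : s = 0 := by simpa [hK0] using h2
      have ht : t = 0 := by simpa using h3
      subst hs ht
      have : w = 0 := hinj (by simpa using h)
      simp [this]
    · rintro ⟨⟨s, t⟩, w⟩
      simp only [LinearMap.coprod_apply, LinearMap.toSpanSingleton_apply,
        ContinuousLinearMap.coe_coe, form_add_right, form_smul_right, form_sub_left,
        form_add_left, form_smul_left, form_self, hXT, hNN, hNX, hNT,
        form_comm K (X z : Ambient n) (N (X z)), form_comm K q, hq _ (hmem z hz), hNq, hqv z hz]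
      linear_combination (-s * d) * hK
  have hspan' : ∀ z ∈ W, q = (K * d + κ * (κ * d + form K A q)) • (X z : Ambient n)
      + (κ * d + form K A q) • A := by
    intro z hz
    refine (hspan z hz).trans ?_
    rw [hA _ (hmem z hz)]
    module
  refine ⟨κ * d + form K A q, ?_⟩
  set a := K * d + κ * (κ * d + form K A q)
  obtain ⟨hXd, hinj, -⟩ := hX z₀ hz₀
  -- In q = a x + b A everything but x is constant, while x has injective derivative on a space of
  -- dimension n ≥ 1; so a = 0.
  have ha : a = 0 := by
    have hd : HasFDerivAt (fun y => a • (X y : Ambient n))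
        (a • fderiv ℝ (fun y => (X y : Ambient n)) z₀) z₀ := hXd.hasFDerivAt.const_smul a
    have hc : (fun y => a • (X y : Ambient n)) =ᶠ[nhds z₀]
        fun _ => q - (κ * d + form K A q) • A := by
      filter_upwards [hW.mem_nhds hz₀] with y hy
      rw [eq_sub_iff_add_eq]
      exact (hspan' y hy).symm
    have h0 := (hd.congr_of_eventuallyEq hc.symm).unique (hasFDerivAt_const _ z₀)
    by_contra ha
    have h1 : fderiv ℝ (fun y => (X y : Ambient n)) z₀ = 0 := (smul_eq_zero.1 h0).resolve_left ha
    have h2 : EuclideanSpace.single (⟨0, hn⟩ : Fin n) (1 : ℝ) = 0 := hinj (by simp [h1])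
    simp at h2
  have := hspan' z₀ hz₀
  rwa [ha, zero_smul, zero_add] at this

end Umbilical

/-! ### Distances -/

/-- Reverse Cauchy–Schwarz: if a, b are the norms of the spatial parts, the product of the time
components is √((1 + a²)(1 + b²)) ≥ 1 + ab. -/
lemma form_le_neg_one {n : ℕ} (p q : spaceForm (-1) n) :
    form (-1) (p : Ambient n) q ≤ -1 := by
  have hp := p.2.1
  have hq := q.2.1
  have hp0 := p.2.2 (by norm_num)
  have hq0 := q.2.2 (by norm_num)
  have hpq := real_inner_le_norm (p : Ambient n).2 (q : Ambient n).2
  simp only [form, real_inner_self_eq_norm_sq] at hp hq ⊢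
  set a := ‖(p : Ambient n).2‖
  set b := ‖(q : Ambient n).2‖
  have h : 1 + a * b ≤ (p : Ambient n).1 * (q : Ambient n).1 := by
    refine le_of_sq_le_sq ?_ (mul_pos hp0 hq0).le
    have e : ((p : Ambient n).1 * (q : Ambient n).1) ^ 2 = (1 + a ^ 2) * (1 + b ^ 2) := by
      rw [mul_pow, show (p : Ambient n).1 ^ 2 = 1 + a ^ 2 by linarith,
        show (q : Ambient n).1 ^ 2 = 1 + b ^ 2 by linarith]
    rw [e]
    nlinarith [sq_nonneg (a - b)]
  linarith

lemma abs_form_le_one {n : ℕ} (p q : spaceForm 1 n) :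
    |form 1 (p : Ambient n) q| ≤ 1 := by
  have hp := p.2.1
  have hq := q.2.1
  have hpq := abs_real_inner_le_norm (p : Ambient n).2 (q : Ambient n).2
  simp only [form, real_inner_self_eq_norm_sq] at hp hq ⊢
  set a := ‖(p : Ambient n).2‖
  set b := ‖(q : Ambient n).2‖
  rw [one_mul]
  refine (abs_add_le _ _).trans ?_
  rw [abs_mul]
  have h1 := two_mul_le_add_sq |(p : Ambient n).1| |(q : Ambient n).1|
  have h2 := two_mul_le_add_sq a b
  rw [sq_abs, sq_abs] at h1
  linarith

/-- A unit timelike vector that has negative product with a point of the upper sheet lies in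
the upper sheet. -/
lemma mem_spaceForm_of_form_neg {n : ℕ} {v : Ambient n} (hv : form (-1) v v = -1)
    (x : spaceForm (-1) n) (hvx : form (-1) (x : Ambient n) v < 0) : v ∈ spaceForm (-1) n := by
  refine ⟨hv, fun _ => ?_⟩
  by_contra h
  have h0 : v.1 ≠ 0 := by
    intro h0
    simp only [form, h0, real_inner_self_eq_norm_sq] at hv
    nlinarith [sq_nonneg ‖v.2‖]
  have hlt : v.1 < 0 := lt_of_le_of_ne (not_lt.1 h) h0
  -- Otherwise -v lies in the upper sheet, and `form_le_neg_one` forces ⟨x, v⟩ ≥ 1.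
  have hmem : (-1 : ℝ) • v ∈ spaceForm (-1) n :=
    ⟨by rw [form_smul_left, form_smul_right, hv]; norm_num, fun _ => by simpa using hlt⟩
  have := form_le_neg_one x ⟨_, hmem⟩
  simp only [form_smul_right] at this
  linarith

/-- The bounds on the form put its values where cos ∘ arccos and cosh ∘ arcosh are the identity. -/
lemma deriv_warping_geodesicDist {K : ℝ} (hK : K = 1 ∨ K = -1) {n : ℕ} (x p : spaceForm K n) :
    deriv (warping K) (geodesicDist K x p) = K * form K (x : Ambient n) p := by
  rcases hK with rfl | rfl
  · have h := abs_le.1 (abs_form_le_one x p)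
    simp [warping, geodesicDist, Real.cos_arccos h.1 h.2]
  · have h := form_le_neg_one x p
    have h0 : ¬ (0 : ℝ) < -1 := by norm_num
    simp only [warping, geodesicDist, h0, if_false, Real.deriv_sinh]
    rw [Real.cosh_arcosh (by linarith)]
    ring

lemma form_eq_of_geodesicDist_eq {K : ℝ} (hK : K = 1 ∨ K = -1) {n : ℕ} {x p : spaceForm K n}
    {R : ℝ} (h : geodesicDist K x p = R) : form K (x : Ambient n) p = K * deriv (warping K) R := by
  have hKK : K * K = 1 := by rcases hK with rfl | rfl <;> norm_num
  rw [← h, deriv_warping_geodesicDist hK, ← mul_assoc, hKK, one_mul]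

lemma exists_geodesicDist_eq {K : ℝ} {n : ℕ} {S : Set (spaceForm K n)} {p : spaceForm K n}
    {d : ℝ} (h : ∀ x ∈ S, form K (x : Ambient n) p = d) :
    ∃ R, ∀ x ∈ S, geodesicDist K x p = R :=
  ⟨if 0 < K then Real.arccos d else Real.arcosh (-d), fun x hx => by rw [geodesicDist, h x hx]⟩

/-- The choice of the coefficient and of the base point. -/
lemma IsUmbilical.exists_base_point {n : ℕ} (hn : 1 ≤ n) {K : ℝ} (hK : K = 1 ∨ K = -1) {κ : ℝ}
    {S : Set (spaceForm K n)} {N : spaceForm K n → Ambient n} (hS : IsUmbilical K κ S N)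
    {A : Ambient n} (hA : ∀ x ∈ S, N x = κ • (x : Ambient n) + A)
    (hAA : form K A A = 1 + κ ^ 2 * K)
    (hxA : ∀ x ∈ S, form K (x : Ambient n) A = -(κ * K)) (C : ℝ) :
    ∃ (c₀ : ℝ) (p : spaceForm K n), c₀ * form K A (p : Ambient n) = K * C ∧
      (K = -1 → κ = 0 → c₀ = 1) ∧
      ((∃ q R, ∀ x ∈ S, geodesicDist K x q = R) → ∃ R, ∀ x ∈ S, geodesicDist K x p = R) := by
  obtain ⟨x₀, hx₀⟩ := hS.isConnected.1
  rcases hK with rfl | rfl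
  · have hpos : 0 < 1 + κ ^ 2 := by positivity
    have hs0 := Real.sqrt_pos.2 hpos
    have hss := Real.mul_self_sqrt hpos.le
    set s := √(1 + κ ^ 2)
    -- On the sphere ⟨A, A⟩ = s² > 0, so A/s is a point, and it is a centre because ⟨x, A⟩ is
    -- constant on S.
    refine ⟨C / s, ⟨s⁻¹ • A, ?_, fun h => by norm_num at h⟩, ?_, fun h => by norm_num at h,
      fun _ => exists_geodesicDist_eq (d := s⁻¹ * -(κ * 1)) fun x hx => ?_⟩
    · rw [form_smul_left, form_smul_right, hAA, mul_one, ← hss]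
      field_simp
    · rw [form_smul_right, hAA, mul_one, ← hss]
      field_simp
    · rw [form_smul_right, hxA x hx]
  · by_cases hκ1 : 1 < κ ^ 2
    · have hpos : 0 < κ ^ 2 - 1 := by linarith
      have hs0 := Real.sqrt_pos.2 hpos
      have hss := Real.mul_self_sqrt hpos.le
      have hκ0 : κ ≠ 0 := by rintro rfl; norm_num at hκ1
      -- Here A is timelike. The sign ε makes ⟨x, εA/s⟩ = εκ/s negative, which selects the upper
      -- sheet.
      obtain ⟨ε, hε, hεκ⟩ : ∃ ε : ℝ, ε * ε = 1 ∧ ε * κ < 0 := by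
        rcases hκ0.lt_or_gt with h | h
        · exact ⟨1, by norm_num, by linarith⟩
        · exact ⟨-1, by norm_num, by linarith⟩
      set s := √(κ ^ 2 - 1)
      have hs1 : s⁻¹ * s = 1 := inv_mul_cancel₀ hs0.ne'
      refine ⟨C * ε / s, ⟨(ε * s⁻¹) • A, mem_spaceForm_of_form_neg ?_ x₀ ?_⟩, ?_,
        fun _ h => absurd h hκ0, fun _ =>
          exists_geodesicDist_eq (d := ε * s⁻¹ * -(κ * -1)) fun x hx => ?_⟩
      · rw [form_smul_left, form_smul_right, hAA,
          show 1 + κ ^ 2 * -1 = -(s * s) by rw [hss]; ring]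
        linear_combination (-(s⁻¹ * s) ^ 2) * hε - (s⁻¹ * s + 1) * hs1
      · rw [form_smul_right, hxA x₀ hx₀]
        have := mul_neg_of_pos_of_neg (inv_pos.2 hs0) hεκ
        linarith
      · rw [form_smul_right, hAA, show 1 + κ ^ 2 * -1 = -(s * s) by rw [hss]; ring,
          div_eq_mul_inv]
        linear_combination (-C * (s⁻¹ * s) ^ 2) * hε - C * (s⁻¹ * s + 1) * hs1
      · rw [form_smul_right, hxA x hx]
    -- For κ² ≤ 1 the premise is contradictory: a centre q = bA would have ⟨q, q⟩ = b²(1 - κ²) ≥ 0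
    -- instead of -1.
    · have hcenter : ∀ P : Prop, (∃ q R, ∀ x ∈ S, geodesicDist (-1) x q = R) → P := by
        rintro P ⟨q, R, hR⟩
        obtain ⟨b, hb⟩ := hS.eq_smul_axis hn (by norm_num) hA (q := q)
          fun x hx => form_eq_of_geodesicDist_eq (Or.inr rfl) (hR x hx)
        have h := form_self q
        rw [hb, form_smul_left, form_smul_right, hAA] at h
        have := mul_nonneg (mul_self_nonneg b) (show 0 ≤ 1 + κ ^ 2 * -1 by linarith)
        nlinarith
      by_cases hκ0 : κ = 0
      · subst hκ0
        have hx0 := hxA x₀ hx₀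
        have hAx : form (-1) A x₀ = 0 := by rw [form_comm, hx0]; ring
        have hC : 0 < 1 + C ^ 2 := by positivity
        have hss := Real.mul_self_sqrt hC.le
        have hs := Real.sqrt_pos.2 hC
        -- Now A is a unit vector orthogonal to x₀. The base point is on the geodesic through x₀ in
        -- direction A, placed so that ⟨A, p⟩ = -C.
        refine ⟨1, ⟨(-C) • A + √(1 + C ^ 2) • (x₀ : Ambient n),
          mem_spaceForm_of_form_neg ?_ x₀ ?_⟩, ?_, fun _ _ => rfl, hcenter _⟩
        · simp only [form_add_left, form_add_right, form_smul_left, form_smul_right, hAA, hx0,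
            hAx, form_self]
          linear_combination -hss
        · simp only [form_add_right, form_smul_right, hx0, form_self]
          linarith
        · simp only [form_add_right, form_smul_right, hAA, hAx]
          ring
      -- Any point of S serves, since ⟨A, x₀⟩ = κ ≠ 0.
      · refine ⟨-C / κ, x₀, ?_, fun _ h => absurd h hκ0, hcenter _⟩
        rw [form_comm, hxA x₀ hx₀]
        field_simp

end

end SpaceFormGeometry

/-! ### The main theorem -/

theorem mainTheorem3 (n : ℕ) (hn : 1 ≤ n) (K : ℝ) (hK : K = 1 ∨ K = -1) (κ ctilde : ℝ)
    (S : Set (SpaceFormGeometry.spaceForm K n))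
    (N : SpaceFormGeometry.spaceForm K n → SpaceFormGeometry.Ambient n)
    (hS : SpaceFormGeometry.IsUmbilical K κ S N) :
    ∃ φ : SpaceFormGeometry.spaceForm K n → ℝ,
      SpaceFormGeometry.IsSmooth K φ ∧
      SpaceFormGeometry.HessianEq K φ (fun x => 1 / ((n : ℝ) + 1) - K * φ x) ∧
      (∀ x ∈ S, SpaceFormGeometry.DirDerivEq K φ x (N x) (κ * φ x + ctilde)) ∧
      ∃ (c₀ : ℝ) (p : SpaceFormGeometry.spaceForm K n),
        (∀ x, φ x = c₀ * deriv (SpaceFormGeometry.warping K) (SpaceFormGeometry.geodesicDist K x p)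
          + K / ((n : ℝ) + 1)) ∧
        (K = -1 → κ = 0 → c₀ = 1) ∧
        ((∃ q R, ∀ x ∈ S, SpaceFormGeometry.geodesicDist K x q = R) →
          ∃ R, ∀ x ∈ S, SpaceFormGeometry.geodesicDist K x p = R) := by
  have hKK : K * K = 1 := by rcases hK with rfl | rfl <;> norm_num
  obtain ⟨A, hA, hAA, hxA⟩ := hS.exists_axis hKK
  obtain ⟨c₀, p, hp, hc₀, hcenter⟩ :=
    -- The term κK/(n+1) compensates for the additive constant of φ on the right-hand side κφ + c̃.
    hS.exists_base_point hn hK hA hAA hxA (κ * (K / ((n : ℝ) + 1)) + ctilde)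
  refine ⟨fun x => SpaceFormGeometry.form K (x : SpaceFormGeometry.Ambient n)
      ((c₀ * K) • (p : SpaceFormGeometry.Ambient n)) + K / ((n : ℝ) + 1),
    fun U F hF => hF.contDiffOn_affine _ _, fun U F hF x hx i j => ?_,
    fun x hx U F hF y hy hyx e he => ?_, c₀, p, fun x => ?_, hc₀, hcenter⟩
  · rw [hF.hessian_affine hKK hx]
    linear_combination (SpaceFormGeometry.metricIn K F x i j / ((n : ℝ) + 1)) * hKK
  · rw [hF.fderiv_affine hy]
    rw [SpaceFormGeometry.dParam, he, hA x hx, SpaceFormGeometry.form_add_left,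
      SpaceFormGeometry.form_smul_left]
    simp only [SpaceFormGeometry.form_smul_right]
    linear_combination K * hp + (κ * (K / ((n : ℝ) + 1)) + ctilde) * hKK
  · simp only [SpaceFormGeometry.deriv_warping_geodesicDist hK, SpaceFormGeometry.form_smul_right]
    ring
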